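/- Let $P$ be a connected link diagram (for instance, a knot diagram) whose all-$A$ splicing consists of a single circle. Let $\mathbb D=\mathbb D(A)$ be the all-$A$ dessin of $P$, that is, the ribbon graph whose vertices are the circles of the all-$A$ splicing and whose edges are the crossings, the edges being attached along the circles in the order in which they occur there, where a circle is oriented counterclockwise if it lies inside an even number of other circles and clockwise otherwise. So $\mathbb D$ has one vertex and is a chord diagram with $e(\mathbb D)$ chords, one for each crossing of $P$. Call two chords $\{a,b\}$, $\{a',b'\}$ neighbouring and parallel if, for a suitable naming of their ends, $a'$ directly follows $a$ and $b$ directly follows $b'$ in the cyclic order on the circle; call two chords parallel if they are related by the equivalence relation generated by this. Let $\tilde{\mathbb D}$ be the weighted dessin obtained from $\mathbb D$ by keeping exactly one chord $c$ of each class of parallel chords, weighted with the number $\mu(c)\ge 1$ of chords in its class. For a spanning sub-dessin $\tilde{\mathbb H}\subset\tilde{\mathbb D}$ (obtained by deleting edges and keeping the vertex) let $g(\tilde{\mathbb H})$ be its genus, $2g=2k-v+e-f$, where $k,v,e,f$ are the numbers of components, vertices, edges and faces. Let $$\langle P\rangle=\sum_{s}A^{a(s)-b(s)}(-A^2-A^{-2})^{|s|-1}\in\mathbb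 Z[A,A^{-1}]$$ be the Kauffman bracket, where $s$ runs over all states (a choice of an $A$- or a $B$-splicing at every crossing), $a(s)$ and $b(s)$ are the numbers of $A$- and $B$-splicings in $s$, and $|s|$ is the number of circles of $s$. Then, in the field of fractions of $\mathbb Z[A,A^{-1}]$, $$\langle P\rangle=\sum_{\tilde{\mathbb H}\subset\tilde{\mathbb D}}A^{e(\mathbb D)-4g(\tilde{\mathbb H})}\,(-1-A^{-4})^{-2g(\tilde{\mathbb H})}\prod_{c\in\tilde{\mathbb H}}\bigl(-1+(-A^{-4})^{\mu(c)}\bigr).$$ For odd $\mu(c)$ the factor of $c$ is $-1-A^{-4\mu(c)}$. -/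

import Mathlib

open Equiv LaurentPolynomial

noncomputable section

/-! ### Dessins (combinatorial maps) -/

/-- A dessin d'enfant (oriented ribbon graph): a multigraph with vertex set `V`, edge set `E` and
set of half-edges (darts) `D`, loops and multiple edges allowed, together with a cyclic order of
the darts at every vertex. `rot d` is the next dart after `d` in the cyclic order at the vertex of
`d`, and `flip d` is the other half of the edge of `d`. Vertices without darts are allowed. -/
structure Dessin (V E D : Type*) where
  /-- the vertex at which a dart starts -/
  vert : D → V
  /-- the edge to which a dart belongs -/
  edge : D → E
  /-- the rotation: next dart in the cyclic order at the vertex -/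
  rot : Perm D
  /-- the opposite dart of the same edge -/
  flip : Perm D
  flip_flip : ∀ d, flip (flip d) = d
  flip_ne : ∀ d, flip d ≠ d
  edge_surjective : Function.Surjective edge
  edge_eq_iff : ∀ d d', edge d = edge d' ↔ d' = d ∨ d' = flip d
  vert_eq_iff : ∀ d d', vert d = vert d' ↔ rot.SameCycle d d'

/-- Some positive iterate of a permutation of a finite set brings a point back to a set. -/
theorem exists_return {D : Type*} [Finite D] (σ : Perm D) (S : Set D) (d : S) :
    ∃ n : ℕ, 0 < n ∧ (σ ^ n) d ∈ S :=
  ⟨orderOf σ, orderOf_pos σ, by rw [pow_orderOf_eq_one]; exact d.2⟩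

open Classical in
/-- The first `n ≥ 1` for which `σ ^ n` brings the point `d` of `S` back to `S`. -/
def returnTime {D : Type*} [Finite D] (σ : Perm D) (S : Set D) (d : S) : ℕ :=
  Nat.find (exists_return σ S d)

theorem returnTime_pos {D : Type*} [Finite D] (σ : Perm D) (S : Set D) (d : S) :
    0 < returnTime σ S d := by
  classical exact (Nat.find_spec (exists_return σ S d)).1

theorem returnTime_mem {D : Type*} [Finite D] (σ : Perm D) (S : Set D) (d : S) :
    (σ ^ returnTime σ S d) d ∈ S := by
  classical exact (Nat.find_spec (exists_return σ S d)).2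

theorem returnTime_le {D : Type*} [Finite D] (σ : Perm D) (S : Set D) (d : S) {n : ℕ}
    (hn : 0 < n) (h : (σ ^ n) d ∈ S) : returnTime σ S d ≤ n := by
  classical exact Nat.find_min' (exists_return σ S d) ⟨hn, h⟩

theorem returnMap_injective {D : Type*} [Finite D] (σ : Perm D) (S : Set D) :
    Function.Injective fun d : S => (⟨_, returnTime_mem σ S d⟩ : S) := by
  have key : ∀ d d' : S, returnTime σ S d ≤ returnTime σ S d' →
      (σ ^ returnTime σ S d) d = (σ ^ returnTime σ S d') d' → d = d' := by
    intro d d' hle h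
    obtain ⟨k, hk⟩ := Nat.exists_eq_add_of_le hle
    rw [hk, pow_add, Perm.mul_apply] at h
    have h2 : (d : D) = (σ ^ k) d' := (σ ^ returnTime σ S d).injective h
    rcases Nat.eq_zero_or_pos k with rfl | hkpos
    · exact Subtype.ext (by simpa using h2)
    · have := returnTime_le σ S d' hkpos (h2 ▸ d.2)
      have := returnTime_pos σ S d
      omega
  intro d d' h
  have h' := congrArg Subtype.val h
  rcases le_total (returnTime σ S d) (returnTime σ S d') with hle | hle
  · exact key d d' hle h'
  · exact (key d' d hle h'.symm).symm

/-- The cyclic orders induced on a subset `S`: the next point of `S` after `d` on the `σ`-cycle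
of `d`. -/
def inducedPerm {D : Type*} [Finite D] (σ : Perm D) (S : Set D) : Perm S :=
  Equiv.ofBijective _ (Finite.injective_iff_bijective.mp (returnMap_injective σ S))

theorem inducedPerm_apply {D : Type*} [Finite D] (σ : Perm D) (S : Set D) (d : S) :
    ((inducedPerm σ S d : S) : D) = (σ ^ returnTime σ S d) d := rfl

theorem inducedPerm_sameCycle_iff {D : Type*} [Finite D] (σ : Perm D) (S : Set D) (d d' : S) :
    (inducedPerm σ S).SameCycle d d' ↔ σ.SameCycle (d : D) d' := by
  constructor
  · intro h
    obtain ⟨n, rfl⟩ := h.exists_nat_pow_eq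
    induction n with
    | zero => exact Perm.SameCycle.refl _ _
    | succ n ih =>
      refine (ih ⟨n, by simp⟩).trans ?_
      rw [pow_succ', Perm.mul_apply, inducedPerm_apply]
      exact ⟨(returnTime σ S ((inducedPerm σ S ^ n) d) : ℤ), by rw [zpow_natCast]⟩
  · intro h
    obtain ⟨n, hn⟩ := h.exists_nat_pow_eq
    clear h
    induction n using Nat.strong_induction_on generalizing d with
    | _ n ih =>
      rcases Nat.eq_zero_or_pos n with rfl | hpos
      · have : d = d' := Subtype.ext (by simpa using hn)
        exact this ▸ Perm.SameCycle.refl _ _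
      · have hle := returnTime_le σ S d hpos (hn ▸ d'.2)
        have hp := returnTime_pos σ S d
        have := ih (n - returnTime σ S d) (by omega) (inducedPerm σ S d) (by
          rw [inducedPerm_apply, ← Perm.mul_apply, ← pow_add, Nat.sub_add_cancel hle, hn])
        exact Perm.sameCycle_apply_left.mp this

namespace Dessin

variable {V E D : Type*}

/-- The number of vertices. -/
def numVertices (_ : Dessin V E D) : ℕ := Nat.card V

/-- The number of edges. -/
def numEdges (_ : Dessin V E D) : ℕ := Nat.card E

/-- The number of connected components of the underlying graph. -/
def numComponents (G : Dessin V E D) : ℕ :=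
  Nat.card (Quot fun v w : V => ∃ d, G.vert d = v ∧ G.vert (G.flip d) = w)

/-- The number of faces: the boundary walks `d ↦ rot (flip d)`, and in addition one face for each
isolated vertex. -/
def numFaces (G : Dessin V E D) : ℕ :=
  Nat.card (Quotient (Perm.SameCycle.setoid (G.rot * G.flip))) +
    Nat.card {v : V // ∀ d, G.vert d ≠ v}

/-- The genus `(2k - v + e - f) / 2`. -/
def genus (G : Dessin V E D) : ℤ :=
  (2 * (G.numComponents : ℤ) - G.numVertices + G.numEdges - G.numFaces) / 2

/-- The spanning sub-dessin with edge set `H`: all edges outside `H` are deleted, all vertices are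
kept, and the remaining darts at each vertex keep their cyclic order. -/
def sub [Finite D] (G : Dessin V E D) (H : Finset E) :
    Dessin V {e // e ∈ H} {d : D | G.edge d ∈ H} where
  vert d := G.vert d.1
  edge d := ⟨G.edge d.1, d.2⟩
  rot := inducedPerm G.rot {d : D | G.edge d ∈ H}
  flip := G.flip.subtypePerm fun d => by
    have : G.edge d = G.edge (G.flip d) := (G.edge_eq_iff _ _).mpr (Or.inr rfl)
    change G.edge (G.flip d) ∈ H ↔ G.edge d ∈ H
    rw [this]
  flip_flip d := Subtype.ext (G.flip_flip d.1)
  flip_ne d h := G.flip_ne d.1 (congrArg Subtype.val h)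
  edge_surjective e := by
    obtain ⟨d, hd⟩ := G.edge_surjective e.1
    exact ⟨⟨d, by change G.edge d ∈ H; rw [hd]; exact e.2⟩, Subtype.ext hd⟩
  edge_eq_iff d d' := by
    rw [Subtype.ext_iff, Subtype.ext_iff, Subtype.ext_iff]
    exact G.edge_eq_iff d.1 d'.1
  vert_eq_iff d d' := by
    rw [inducedPerm_sameCycle_iff]
    exact G.vert_eq_iff d.1 d'.1

/-- Two chords of a one-vertex dessin (a chord diagram) are neighbouring and parallel if an end
`rot d` of the second one directly follows an end `d` of the first one on the circle, and
the other end `flip d` of the first one directly follows the other end of the second one. -/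
def NeighbouringParallel (G : Dessin V E D) (e e' : E) : Prop :=
  ∃ d, G.edge d = e ∧ G.edge (G.rot d) = e' ∧ G.rot (G.flip (G.rot d)) = G.flip d

/-- Two chords are parallel if they are joined by a sequence of chords, each one neighbouring and
parallel to the next. -/
def Parallel (G : Dessin V E D) (e e' : E) : Prop :=
  Relation.EqvGen G.NeighbouringParallel e e'

end Dessin

/-- A dessin whose edges carry weights in `ℕ`. -/
structure WeightedDessin (V E D : Type*) extends Dessin V E D where
  /-- the weight of an edge -/
  weight : E → ℕ

/-- The weighted dessin obtained from a dessin by keeping only the edges in `R`, each edge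
`c ∈ R` being weighted with the number of edges parallel to `c` (including `c` itself). If `R`
contains exactly one edge from each class of parallel edges, then this is the collapse of each
class of parallel edges to a single weighted edge. -/
def Dessin.collapse {V E D : Type*} [Finite D] (G : Dessin V E D) (R : Finset E) :
    WeightedDessin V {e // e ∈ R} {d : D | G.edge d ∈ R} where
  toDessin := G.sub R
  weight c := Nat.card {e : E // G.Parallel c e}

/-! ### Link diagrams -/

/-- At a crossing the four half-edges are numbered `0, 1, 2, 3` in counterclockwise order. `turn`
rotates every crossing by one step in the counterclockwise direction. -/
def turn (C : Type*) : Perm (C × ZMod 4) :=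
  Equiv.prodCongrRight fun _ => Equiv.addRight 1

/-- A connected link diagram, given by the combinatorial map of its underlying 4-valent plane graph
(on the oriented sphere), with set of crossings `C`.
The half-edges at a crossing `c` are `(c, 0), (c, 1), (c, 2), (c, 3)` in counterclockwise order;
`(c, 0)` and `(c, 2)` belong to the under-strand and `(c, 1)` and `(c, 3)` to the over-strand.
`glue` maps a half-edge to the half-edge at the other end of the same edge of the diagram.
If `C` is empty then the diagram is a single circle without crossings. -/
structure LinkDiagram (C : Type*) where
  glue : Perm (C × ZMod 4)
  glue_glue : ∀ h, glue (glue h) = h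
  glue_ne : ∀ h, glue h ≠ h
  /-- the diagram is connected -/
  connected : ∀ h h', ∃ g ∈ Subgroup.closure {turn C, glue}, g h = h'
  /-- the surface carrying the diagram is a sphere: vertices - edges + faces = 2 -/
  planar : Nonempty C →
    Nat.card C + Nat.card (Quotient (Perm.SameCycle.setoid ((turn C)⁻¹ * glue))) =
      Nat.card (Quotient (Perm.SameCycle.setoid glue)) + 2

/-- The `A`-splicing of a crossing joins the half-edges `0, 1` and `2, 3`, so that the two regions
merge which the over-strand sweeps out when it is turned counterclockwise. -/
def joinA : Perm (ZMod 4) := swap 0 1 * swap 2 3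

/-- The `B`-splicing of a crossing joins the half-edges `1, 2` and `3, 0`. -/
def joinB : Perm (ZMod 4) := swap 1 2 * swap 3 0

open Classical in
/-- The splicing of all crossings in the Kauffman state that has a `B`-splicing at the crossings
in `s` and an `A`-splicing at all others. -/
def splice {C : Type*} (s : Finset C) : Perm (C × ZMod 4) :=
  Equiv.prodCongrRight fun c => if c ∈ s then joinB else joinA

namespace LinkDiagram

variable {C : Type*} (P : LinkDiagram C)

/-- The equivalence relation on half-edges: lying on the same circle of the Kauffman state `s`. -/
def circleSetoid (s : Finset C) : Setoid (C × ZMod 4) :=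
  MulAction.orbitRel (Subgroup.closure {P.glue, splice s}) (C × ZMod 4)

/-- The circles of the Kauffman state `s`. If there are no crossings, there is exactly one. -/
abbrev Circle (s : Finset C) : Type _ :=
  Quotient (P.circleSetoid s) ⊕ PLift (IsEmpty C)

/-- The Kauffman bracket, normalized to be `1` on the diagram of the unknot without crossings:
the sum over all states of `A ^ (#A - #B) * (-A² - A⁻²) ^ (number of circles - 1)`. -/
def bracket [Fintype C] : ℤ[T;T⁻¹] :=
  ∑ s : Finset C, T ((Fintype.card C : ℤ) - 2 * s.card) *
    (-T 2 - T (-2)) ^ (Nat.card (P.Circle s) - 1)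

/-- A checkerboard shading of the regions of the diagram. `shade h` tells whether the region at
the corner between the half-edges `h` and `turn h` is shaded. Neighbouring corners at a crossing,
and the regions on both sides of an edge, have different shades. A connected diagram with
crossings has exactly two shadings. A region of the diagram in the plane is shaded, in the shading for which
the unbounded region is not, if and only if it lies inside an odd number of circles of any
Kauffman state. -/
structure Shading where
  shade : C × ZMod 4 → Bool
  shade_turn : ∀ h, shade (turn C h) = !shade h
  shade_glue : ∀ h, shade (P.glue h) = !shade h

/-- A space of constant functions has dimension at most one. -/
theorem finrank_le_one_of_const {ι : Type*} [Finite ι] (W : Submodule (ZMod 2) (ι → ZMod 2))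
    (hW : ∀ f ∈ W, ∀ i j, f i = f j) : Module.finrank (ZMod 2) W ≤ 1 := by
  rcases isEmpty_or_nonempty ι with hι | ⟨⟨i⟩⟩
  · rw [Module.finrank_zero_of_subsingleton]; exact Nat.zero_le _
  · have : Function.Injective ((LinearMap.proj i).comp W.subtype : W →ₗ[ZMod 2] ZMod 2) := by
      intro f g h
      refine Subtype.ext (funext fun j => ?_)
      rw [hW f f.2 j i, hW g g.2 j i]
      exact h
    simpa using LinearMap.finrank_le_finrank_of_injective this

/-- Every connected link diagram has a checkerboard shading. -/
theorem exists_shading {C : Type*} [Finite C] (P : LinkDiagram C) : Nonempty P.Shading := by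
  classical
  have := Fintype.ofFinite C
  rcases isEmpty_or_nonempty C with hC | hC
  · exact ⟨⟨fun _ => true, fun h => hC.elim h.1, fun h => hC.elim h.1⟩⟩
  let X := C × ZMod 4
  let sE : Setoid X := Perm.SameCycle.setoid P.glue
  let sF : Setoid X := Perm.SameCycle.setoid ((turn C)⁻¹ * P.glue)
  let QE := Quotient sE
  let QF := Quotient sF
  let mE : X → QE := Quotient.mk sE
  let mF : X → QF := Quotient.mk sF
  have : Fintype QE := Fintype.ofFinite _
  have : Fintype QF := Fintype.ofFinite _
  have hcard : Fintype.card C + Fintype.card QF = Fintype.card QE + 2 := by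
    have := P.planar hC
    rwa [Nat.card_eq_fintype_card, Nat.card_eq_fintype_card, Nat.card_eq_fintype_card] at this
  -- edge classes
  have hE : ∀ h h' : X, mE h = mE h' ↔ h' = h ∨ h' = P.glue h := by
    intro h h'
    rw [show (mE h = mE h') = (P.glue.SameCycle h h') from propext Quotient.eq]
    constructor
    · intro hs
      obtain ⟨n, rfl⟩ := hs.exists_nat_pow_eq
      induction n with
      | zero => exact Or.inl rfl
      | succ n ih =>
        rw [pow_succ', Perm.mul_apply]
        rcases ih ⟨n, by simp⟩ with e | e
        · right; rw [e]
        · left; rw [e, P.glue_glue]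
    · rintro (rfl | rfl)
      · exact Perm.SameCycle.refl _ _
      · exact Perm.sameCycle_apply_right.mpr (Perm.SameCycle.refl _ _)
  have hFg : ∀ h : X, mF (P.glue h) = mF ((turn C)⁻¹ h) := by
    intro h
    refine Quotient.sound (s := sF) ?_
    change Perm.SameCycle _ _ _
    have : (turn C)⁻¹ h = ((turn C)⁻¹ * P.glue) (P.glue h) := by
      rw [Perm.mul_apply, P.glue_glue]
    rw [this]
    exact Perm.sameCycle_apply_right.mpr (Perm.SameCycle.refl _ _)
  -- functions invariant under both generators are constant
  have hconst : ∀ g : X → ZMod 2, (∀ h, g (P.glue h) = g h) → (∀ h, g (turn C h) = g h) →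
      ∀ h h', g h = g h' := by
    intro g h1 h2 h h'
    obtain ⟨a, ha, rfl⟩ := P.connected h h'
    have : ∀ x, g (a x) = g x := by
      clear h
      induction ha using Subgroup.closure_induction with
      | mem y hy =>
        rcases hy with rfl | rfl
        · exact h2
        · exact h1
      | one => exact fun x => rfl
      | mul a b _ _ ha hb => exact fun x => (ha (b x)).trans (hb x)
      | inv a _ ha =>
        intro x
        rw [← ha (a⁻¹ x), ← Perm.mul_apply, mul_inv_cancel, Perm.one_apply]
    exact (this h).symm
  -- the incidence matrix of the underlying graph, modulo 2
  let M : Matrix C QE (ZMod 2) := fun c q => ∑ i : ZMod 4, if mE (c, i) = q then 1 else 0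
  have hMT : ∀ (v : C → ZMod 2) (h : X), M.transpose.mulVec v (mE h) = v h.1 + v (P.glue h).1 := by
    intro v h
    have h1 : M.transpose.mulVec v (mE h) = ∑ x : X, if mE x = mE h then v x.1 else 0 := by
      rw [Fintype.sum_prod_type]
      change ∑ c : C, (∑ i : ZMod 4, if mE (c, i) = mE h then (1 : ZMod 2) else 0) * v c = _
      simp only [Finset.sum_mul, ite_mul, one_mul, zero_mul]
    rw [h1, ← Finset.sum_filter]
    have h2 : (Finset.univ.filter fun x : X => mE x = mE h) = {h, P.glue h} := by
      ext x
      simp only [Finset.mem_filter, Finset.mem_univ, true_and, Finset.mem_insert,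
        Finset.mem_singleton]
      rw [eq_comm, hE]
    rw [h2, Finset.sum_pair (P.glue_ne h).symm]
  have hM : ∀ (u : QE → ZMod 2) (c : C), M.mulVec u c = ∑ i : ZMod 4, u (mE (c, i)) := by
    intro u c
    change ∑ q : QE, (∑ i : ZMod 4, if mE (c, i) = q then (1 : ZMod 2) else 0) * u q = _
    simp only [Finset.sum_mul, ite_mul, one_mul, zero_mul]
    rw [Finset.sum_comm]
    exact Finset.sum_congr rfl fun i _ =>
      (Finset.sum_ite_eq Finset.univ (mE (c, i)) u).trans (if_pos (Finset.mem_univ _))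
  have two : ∀ a b : ZMod 2, a + b = 0 → a = b := by decide
  have hkerT : Module.finrank (ZMod 2) (LinearMap.ker M.transpose.mulVecLin) ≤ 1 := by
    refine finrank_le_one_of_const _ fun f hf c c' => ?_
    have h0 : M.transpose.mulVec f = 0 := hf
    refine hconst (fun x => f x.1) (fun h => ?_) (fun h => rfl) (c, 0) (c', 0)
    have := hMT f h
    rw [h0] at this
    exact (two _ _ this.symm).symm
  have hker : Module.finrank (ZMod 2) (LinearMap.ker M.mulVecLin) + 1 ≤ Fintype.card QF := by
    have h1 := LinearMap.finrank_range_add_finrank_ker M.mulVecLin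
    have h2 := LinearMap.finrank_range_add_finrank_ker M.transpose.mulVecLin
    have h3 := M.rank_transpose
    rw [Matrix.rank, Matrix.rank] at h3
    rw [Module.finrank_fintype_fun_eq_card] at h1 h2
    omega
  -- the coboundary of a function on faces
  have hδ : ∀ (f : QF → ZMod 2) (a b : X), sE.r a b →
      f (mF a) + f (mF (P.glue a)) = f (mF b) + f (mF (P.glue b)) := by
    intro f a b hab
    have : mE a = mE b := Quotient.sound (s := sE) hab
    rcases (hE a b).mp this with rfl | rfl
    · rfl
    · rw [P.glue_glue, add_comm]
  let δ : (QF → ZMod 2) →ₗ[ZMod 2] (QE → ZMod 2) :=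
    { toFun := fun f => Quotient.lift (fun a => f (mF a) + f (mF (P.glue a))) (hδ f)
      map_add' := fun f g => by
        funext q
        refine Quotient.inductionOn q fun a => ?_
        change (f _ + g _) + (f _ + g _) = (f _ + f _) + (g _ + g _)
        ring
      map_smul' := fun r f => by
        funext q
        refine Quotient.inductionOn q fun a => ?_
        change r * f _ + r * f _ = r * (f _ + f _)
        ring }
  have hδa : ∀ f h, δ f (mE h) = f (mF h) + f (mF (P.glue h)) := fun f h => rfl
  have hkerδ : Module.finrank (ZMod 2) (LinearMap.ker δ) ≤ 1 := by
    refine finrank_le_one_of_const _ fun f hf p q => ?_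
    have h0 : δ f = 0 := hf
    have h1 : ∀ h, f (mF (P.glue h)) = f (mF h) := by
      intro h
      have := hδa f h
      rw [h0] at this
      exact (two _ _ this.symm).symm
    refine Quotient.inductionOn₂ p q fun a b => ?_
    refine hconst (fun x => f (mF x)) h1 (fun h => ?_) a b
    have h2 := hFg (turn C h)
    rw [show (turn C)⁻¹ (turn C h) = h from (turn C).symm_apply_apply h] at h2
    have h3 := h1 (turn C h)
    rw [h2] at h3
    exact h3.symm
  have hle : LinearMap.range δ ≤ LinearMap.ker M.mulVecLin := by
    rintro _ ⟨f, rfl⟩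
    change M.mulVec (δ f) = 0
    funext c
    rw [hM]
    simp only [hδa, hFg]
    rw [Finset.sum_add_distrib]
    have : ∑ i : ZMod 4, f (mF ((turn C)⁻¹ (c, i))) = ∑ i : ZMod 4, f (mF (c, i)) :=
      Equiv.sum_comp (Equiv.addRight (1 : ZMod 4)).symm fun i => f (mF (c, i))
    rw [this]
    exact CharTwo.add_self_eq_zero _
  have heq : LinearMap.range δ = LinearMap.ker M.mulVecLin := by
    refine Submodule.eq_of_le_of_finrank_le hle ?_
    have := LinearMap.finrank_range_add_finrank_ker δ
    rw [Module.finrank_fintype_fun_eq_card] at this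
    omega
  have hmem : (fun _ => 1 : QE → ZMod 2) ∈ LinearMap.range δ := by
    rw [heq]
    change M.mulVec _ = 0
    funext c
    rw [hM]
    change ∑ _i : ZMod 4, (1 : ZMod 2) = 0
    decide
  obtain ⟨f, hf⟩ := hmem
  have hb : ∀ a b : ZMod 2, a + b = 1 → decide (b = 1) = !decide (a = 1) := by decide
  have hg : ∀ h, f (mF h) + f (mF (P.glue h)) = 1 := fun h => by rw [← hδa, hf]
  refine ⟨⟨fun h => decide (f (mF h) = 1), fun h => ?_, fun h => hb _ _ (hg h)⟩⟩
  have h1 := hg (turn C h)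
  rw [hFg, show (turn C)⁻¹ (turn C h) = h from (turn C).symm_apply_apply h, add_comm] at h1
  exact hb _ _ h1

variable {P}

theorem joinA_cases (i : ZMod 4) : joinA i = i + 1 ∨ i = joinA i + 1 := by
  revert i; unfold joinA; decide

theorem joinA_joinA (i : ZMod 4) : joinA (joinA i) = i := by
  revert i; unfold joinA; decide

theorem splice_empty_apply (h : C × ZMod 4) :
    splice (∅ : Finset C) h = (h.1, joinA h.2) := by
  obtain ⟨c, i⟩ := h
  simp [splice]

namespace Shading

variable (κ : P.Shading)

theorem shade_add_one (c : C) (i : ZMod 4) : κ.shade (c, i + 1) = !κ.shade (c, i) :=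
  κ.shade_turn (c, i)

theorem shade_add_two (c : C) (i : ZMod 4) : κ.shade (c, i + 2) = κ.shade (c, i) := by
  rw [show i + 2 = i + 1 + 1 by ring, shade_add_one, shade_add_one, Bool.not_not]

theorem shade_splice (h : C × ZMod 4) :
    κ.shade (splice (∅ : Finset C) h) = !κ.shade h := by
  obtain ⟨c, i⟩ := h
  rw [splice_empty_apply]
  rcases joinA_cases i with h | h
  · rw [h]; exact κ.shade_add_one c i
  · have := κ.shade_add_one c (joinA i)
    rw [← h] at this
    change κ.shade (c, joinA i) = !κ.shade (c, i)
    rw [this, Bool.not_not]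

/-- The half-edges with the shaded side on their left, seen from the crossing. If all state
circles are oriented so that the shaded regions are on their left, then these are the half-edges
which are directed away from their crossing. Each of the two arcs of the `A`-splicing at a crossing
contains exactly one of them, the one where the arc leaves the crossing. -/
abbrev Out : Type _ := {h : C × ZMod 4 // κ.shade h = true}

/-- The successor on a circle of the all-`A` state: from an arc to the next arc in the direction
of the orientation. -/
def next : Perm κ.Out :=
  (splice (∅ : Finset C) * P.glue).subtypePerm fun h => by
    rw [Perm.mul_apply, κ.shade_splice, κ.shade_glue, Bool.not_not]

/-- From an arc of the all-`A` state to the other arc at the same crossing. -/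
def opposite : Perm κ.Out :=
  (turn C * turn C).subtypePerm fun h => by
    rw [Perm.mul_apply, κ.shade_turn, κ.shade_turn, Bool.not_not]

theorem opposite_val (h : κ.Out) : (κ.opposite h : C × ZMod 4) = (h.1.1, h.1.2 + 2) := by
  change (h.1.1, h.1.2 + 1 + 1) = _
  rw [show h.1.2 + 1 + 1 = h.1.2 + 2 by ring]

theorem circle_eq_iff (d d' : κ.Out) :
    (P.circleSetoid ∅).r d.1 d'.1 ↔ κ.next.SameCycle d d' := by
  have hβ : ∀ h : C × ZMod 4, splice (∅ : Finset C) (splice (∅ : Finset C) h) = h := by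
    intro h; rw [splice_empty_apply, splice_empty_apply]; exact Prod.ext rfl (joinA_joinA h.2)
  constructor
  · intro h
    -- the half-edges on the circle of `d'`, traversed along the orientation
    let Q : C × ZMod 4 → Prop := fun x =>
      (∀ hx : κ.shade x = true, κ.next.SameCycle d' ⟨x, hx⟩) ∧
      (∀ hx : κ.shade (splice (∅ : Finset C) x) = true, κ.next.SameCycle d' ⟨_, hx⟩)
    have gen1 : ∀ x, Q x → Q (P.glue x) := by
      intro x hx
      refine ⟨fun h1 => ?_, fun h1 => ?_⟩
      · have h2 : κ.shade (splice (∅ : Finset C) x) = true := by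
          rw [κ.shade_splice, ← κ.shade_glue]; exact h1
        have h3 := hx.2 h2
        refine Perm.sameCycle_apply_right.mp ?_
        convert h3 using 1
        refine Subtype.ext ?_
        change splice (∅ : Finset C) (P.glue (P.glue x)) = _
        rw [P.glue_glue]
      · have h2 : κ.shade x = true := by
          rw [κ.shade_splice, κ.shade_glue, Bool.not_not] at h1; exact h1
        exact Perm.sameCycle_apply_right.mpr (hx.1 h2)
    have gen2 : ∀ x, Q x → Q (splice (∅ : Finset C) x) := by
      intro x hx
      refine ⟨fun h1 => hx.2 h1, fun h1 => ?_⟩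
      have h2 : κ.shade x = true := by rw [hβ] at h1; exact h1
      have h3 := hx.1 h2
      convert h3 using 2
      exact hβ x
    have hQ : ∀ g ∈ Subgroup.closure {P.glue, splice (∅ : Finset C)},
        ∀ x, Q x ↔ Q (g x) := by
      intro g hg
      induction hg using Subgroup.closure_induction with
      | mem y hy =>
        rcases hy with rfl | rfl
        · exact fun x => ⟨gen1 x, fun h => by have := gen1 _ h; rwa [P.glue_glue] at this⟩
        · exact fun x => ⟨gen2 x, fun h => by have := gen2 _ h; rwa [hβ] at this⟩
      | one => exact fun x => Iff.rfl
      | mul a b _ _ ha hb => exact fun x => (hb x).trans (ha (b x))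
      | inv a _ ha =>
        intro x
        have := ha (a⁻¹ x)
        rw [← Perm.mul_apply, mul_inv_cancel, Perm.one_apply] at this
        exact this.symm
    obtain ⟨g, hg⟩ := h
    have h1 : Q d'.1 := by
      refine ⟨fun _ => Perm.SameCycle.refl _ _, fun hx => ?_⟩
      rw [κ.shade_splice, d'.2] at hx
      exact absurd hx (by simp)
    have h2 := ((hQ g.1 g.2 _).mp h1).1 (by
      have : g.1 d'.1 = d.1 := hg
      rw [this]; exact d.2)
    have h3 : (⟨g.1 d'.1, by have : g.1 d'.1 = d.1 := hg
                             rw [this]; exact d.2⟩ : κ.Out) = d := Subtype.ext hg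
    rw [h3] at h2
    exact h2.symm
  · intro h
    obtain ⟨n, rfl⟩ := h
    refine Setoid.symm' _ ⟨⟨(splice (∅ : Finset C) * P.glue) ^ n, ?_⟩, ?_⟩
    · exact Subgroup.zpow_mem _ (Subgroup.mul_mem _ (Subgroup.subset_closure (by simp))
        (Subgroup.subset_closure (by simp))) n
    · change ((splice (∅ : Finset C) * P.glue) ^ n) d.1 = _
      rw [next, Perm.subtypePerm_zpow]
      rfl

end Shading

/-- The dessin of the all-`A` state: its vertices are the circles of the all-`A` state, its edges
are the crossings, and its darts are the arcs of the spliced crossings, each represented by the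
half-edge where it leaves the crossing. The cyclic order at a vertex is the order of the arcs along
the oriented circle. All circles are oriented so that the shaded regions are on their left:
if the unbounded region is unshaded, a circle is directed counterclockwise if it is inside an
even number of circles, and clockwise if it is inside an odd number of circles. -/
def dessinA (P : LinkDiagram C) (κ : P.Shading) : Dessin (P.Circle ∅) C κ.Out where
  vert d := Sum.inl (Quotient.mk _ d.1)
  edge d := d.1.1
  rot := κ.next
  flip := κ.opposite
  flip_flip d := by
    refine Subtype.ext ?_
    rw [κ.opposite_val, κ.opposite_val]
    refine Prod.ext rfl ?_
    change d.1.2 + 2 + 2 = d.1.2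
    generalize d.1.2 = i
    revert i; decide
  flip_ne d h := by
    have h2 := congrArg (fun x : κ.Out => x.1.2) h
    simp only [κ.opposite_val] at h2
    generalize d.1.2 = i at h2
    revert i; decide
  edge_surjective c := by
    by_cases h : κ.shade (c, 0) = true
    · exact ⟨⟨_, h⟩, rfl⟩
    · refine ⟨⟨(c, 0 + 1), ?_⟩, rfl⟩
      rw [κ.shade_add_one]; simpa using h
  edge_eq_iff d d' := by
    obtain ⟨⟨c, i⟩, hd⟩ := d
    obtain ⟨⟨c', j⟩, hd'⟩ := d'
    rw [Subtype.ext_iff, Subtype.ext_iff, κ.opposite_val, Prod.mk.injEq, Prod.mk.injEq]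
    constructor
    · rintro rfl
      have hij : j = i ∨ j = i + 2 ∨ j = i + 1 ∨ i = j + 1 := by
        clear hd hd'; revert i j; decide
      rcases hij with h | h | h | h
      · exact Or.inl ⟨rfl, h⟩
      · exact Or.inr ⟨rfl, h⟩
      · subst h; rw [κ.shade_add_one, hd] at hd'; simp at hd'
      · subst h; rw [κ.shade_add_one, hd'] at hd; simp at hd
    · rintro (⟨h, -⟩ | ⟨h, -⟩) <;> exact h.symm
  vert_eq_iff d d' := by
    rw [Sum.inl.injEq, Quotient.eq]
    exact κ.circle_eq_iff d d'

end LinkDiagram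

end

noncomputable section

/-! ### Counting the cycles of a permutation -/

/-! The circles of a state `s` are the faces of the spanning sub-dessin whose edges are the
crossings with a `B`-splicing (`card_circle`). Indeed, replacing an `A`-splicing by a `B`-splicing
exchanges the two arcs at a crossing, so the circles are the cycles of `rot * flipOn s`. With a
single vertex, Euler's formula gives 2g = 1 + |s| - |circles|. Put y = -1 - A⁻⁴, so that -A² - A⁻² =
A²y. The summand of `s` in the bracket then becomes A^(e - 4g) y^(-2g) y^|s|.

The genus depends only on which classes of parallel chords `s` meets. Inserting a chord parallel to
one already present multiplies the face permutation by a transposition of two points of one cycle.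
This splits the cycle and creates exactly one face, so edges minus faces does not change
(`edgesSubFaces_congr`). Hence g is the genus of the sub-dessin spanned by the representatives of
these classes in the collapsed dessin; `numFaces_sub` and `faceCount_sub` make face counts
comparable across deletions.

It remains to sum y^|s| over all `s` meeting exactly the classes in a given set. By the binomial
theorem each class of size μ contributes (1 + y)^μ - 1 (`sum_pow_card_filter_image`), and 1 + y =
-A⁻⁴. -/

/-- The number of cycles of a permutation, fixed points included. -/
def numCycles {D : Type*} (σ : Perm D) : ℕ :=
  Nat.card (Quotient (Perm.SameCycle.setoid σ))

theorem sameCycle_of_step {D : Type*} {σ : Perm D} {r : D → D → Prop} (hr : Equivalence r)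
    (h : ∀ z, r z (σ z)) {x y : D} (hxy : σ.SameCycle x y) : r x y := by
  have key : ∀ (n : ℕ) z, r z ((σ ^ n) z) := by
    intro n z
    induction n with
    | zero => exact hr.refl z
    | succ n ih => rw [pow_succ', Perm.mul_apply]; exact hr.trans ih (h _)
  obtain ⟨n, rfl⟩ := hxy
  obtain ⟨m, rfl | rfl⟩ := n.eq_nat_or_neg
  · simpa using key m x
  · have := key m ((σ ^ (-(m : ℤ))) x)
    rw [← Perm.mul_apply, ← zpow_natCast, ← zpow_add, add_neg_cancel, zpow_zero,
      Perm.one_apply] at this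
    exact hr.symm this

theorem sameCycle_equivalence {D : Type*} (σ : Perm D) : Equivalence σ.SameCycle :=
  (Perm.SameCycle.setoid σ).iseqv

theorem sameCycle_apply_self {D : Type*} (σ : Perm D) (z : D) : σ.SameCycle z (σ z) :=
  Perm.sameCycle_apply_right.mpr (Perm.SameCycle.refl _ _)

/-- Conjugate permutations have the same number of cycles. -/
theorem numCycles_mul_comm {D : Type*} (σ τ : Perm D) : numCycles (σ * τ) = numCycles (τ * σ) := by
  refine Nat.card_congr (Quotient.congr τ fun x y => ?_)
  change (σ * τ).SameCycle x y ↔ (τ * σ).SameCycle (τ x) (τ y)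
  have : τ * σ = τ * (σ * τ) * τ⁻¹ := by group
  rw [this, Perm.sameCycle_conj]
  simp

/-- The arc of the `σ`-cycle from `σ x` to `y` is closed up by the new permutation, which sends `y`
to `σ x`; the point `x` is left outside. -/
theorem not_sameCycle_mul_swap {D : Type*} [DecidableEq D] [Finite D] {σ : Perm D} {x y : D}
    (hxy : x ≠ y) (h : σ.SameCycle x y) : ¬ (σ * swap x y).SameCycle x y := by
  classical
  have hex : ∃ n : ℕ, (σ ^ n) x = y := h.exists_nat_pow_eq
  set k := Nat.find hex with hk
  have hky : (σ ^ k) x = y := Nat.find_spec hex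
  have hmin : ∀ i, i < k → (σ ^ i) x ≠ y := fun i hi => Nat.find_min hex hi
  -- An earlier return to `x` would let `y` be reached in `k - i` steps, against the minimality of
  -- `k`.
  have hx : ∀ i, 0 < i → i ≤ k → (σ ^ i) x ≠ x := by
    intro i hi hik h1
    refine hmin (k - i) (by omega) ?_
    rw [← hky]
    conv_rhs => rw [← Nat.sub_add_cancel hik, pow_add, Perm.mul_apply, h1]
  have hk0 : 0 < k := by
    rcases Nat.eq_zero_or_pos k with h0 | h0
    · rw [h0] at hky; exact absurd hky hxy
    · exact h0
  let S : D → Prop := fun z => ∃ i, 0 < i ∧ i ≤ k ∧ (σ ^ i) x = z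
  have hS : ∀ z, S z → S ((σ * swap x y) z) := by
    rintro _ ⟨i, hi, hik, rfl⟩
    rw [Perm.mul_apply]
    rcases hik.eq_or_lt with rfl | hlt
    · rw [hky, swap_apply_right]
      exact ⟨1, one_pos, hk0, by simp⟩
    · rw [swap_apply_of_ne_of_ne (hx i hi hik) (hmin i hlt)]
      exact ⟨i + 1, by omega, hlt, by rw [pow_succ', Perm.mul_apply]⟩
  intro hs
  obtain ⟨n, hn⟩ := hs.symm.exists_nat_pow_eq
  have : ∀ n : ℕ, S (((σ * swap x y) ^ n) y) := by
    intro n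
    induction n with
    | zero => exact ⟨k, hk0, le_rfl, hky⟩
    | succ n ih => rw [pow_succ', Perm.mul_apply]; exact hS _ ih
  obtain ⟨i, hi, hik, h1⟩ := this n
  exact hx i hi hik (h1.trans hn)

/-- The new permutation sends `x` to `σ y` and then follows the old cycle of `y`, which does not
contain `x`, until it arrives at `y`. -/
theorem sameCycle_mul_swap {D : Type*} [DecidableEq D] [Finite D] {σ : Perm D} {x y : D}
    (h : ¬ σ.SameCycle x y) : (σ * swap x y).SameCycle x y := by
  have key : ∀ i : ℕ, (σ * swap x y).SameCycle x y ∨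
      (σ * swap x y).SameCycle x ((σ ^ (i + 1)) y) := by
    intro i
    induction i with
    | zero =>
      right
      have := sameCycle_apply_self (σ * swap x y) x
      simpa using this
    | succ i ih =>
      rcases ih with ih | ih
      · exact Or.inl ih
      by_cases h1 : (σ ^ (i + 1)) y = y
      · rw [h1] at ih; exact Or.inl ih
      · right
        have h2 : (σ ^ (i + 1)) y ≠ x := by
          intro h2
          exact h (Perm.SameCycle.symm ⟨(i + 1 : ℕ), by rw [zpow_natCast]; exact h2⟩)
        refine ih.trans ?_
        have := sameCycle_apply_self (σ * swap x y) ((σ ^ (i + 1)) y)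
        rwa [Perm.mul_apply, swap_apply_of_ne_of_ne h2 h1, ← Perm.mul_apply, ← pow_succ'] at this
  -- After `orderOf σ` steps the walk along the old cycle is certainly back at `y`.
  rcases key (orderOf σ - 1) with h1 | h1
  · exact h1
  · rwa [Nat.sub_add_cancel (orderOf_pos σ), pow_orderOf_eq_one] at h1

/-- Multiplication by a transposition of two points of a cycle splits the cycle. -/
theorem numCycles_mul_swap_of_sameCycle {D : Type*} [DecidableEq D] [Finite D] {σ : Perm D}
    {x y : D} (hxy : x ≠ y) (h : σ.SameCycle x y) :
    numCycles (σ * swap x y) = numCycles σ + 1 := by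
  classical
  have hn := not_sameCycle_mul_swap hxy h
  set τ := σ * swap x y with hτ
  have hle : ∀ {z w}, τ.SameCycle z w → σ.SameCycle z w := by
    intro z w hzw
    refine sameCycle_of_step (sameCycle_equivalence σ) (fun z => ?_) hzw
    rw [hτ, Perm.mul_apply]
    refine Perm.sameCycle_apply_right.mpr ?_
    rcases eq_or_ne z x with rfl | h1
    · rwa [swap_apply_left]
    rcases eq_or_ne z y with rfl | h2
    · rw [swap_apply_right]; exact h.symm
    · rw [swap_apply_of_ne_of_ne h1 h2]
  -- `U` is the union of the cycles of `x` and `y` under `τ`. A `σ`-step is a `τ`-step except at `x`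
  -- and `y`, where it stays inside `U`.
  let U : D → Prop := fun z => τ.SameCycle x z ∨ τ.SameCycle y z
  have hU : ∀ {z w}, τ.SameCycle z w → U z → U w := fun hzw hz =>
    hz.imp (fun h => h.trans hzw) (fun h => h.trans hzw)
  have hge : ∀ {z w}, σ.SameCycle z w → τ.SameCycle z w ∨ (U z ∧ U w) := by
    intro z w hzw
    refine sameCycle_of_step (r := fun z w => τ.SameCycle z w ∨ (U z ∧ U w))
      ⟨fun z => Or.inl (.refl _ _), ?_, ?_⟩ (fun z => ?_) hzw
    · rintro a b (h | h)
      · exact Or.inl h.symm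
      · exact Or.inr h.symm
    · rintro a b c (h | h) (h' | h')
      · exact Or.inl (h.trans h')
      · exact Or.inr ⟨hU h.symm h'.1, h'.2⟩
      · exact Or.inr ⟨h.1, hU h' h.2⟩
      · exact Or.inr ⟨h.1, h'.2⟩
    · rcases eq_or_ne z x with rfl | h1
      · right
        refine ⟨Or.inl (.refl _ _), Or.inr ?_⟩
        have := sameCycle_apply_self τ y
        rwa [hτ, Perm.mul_apply, swap_apply_right] at this
      rcases eq_or_ne z y with rfl | h2
      · right
        refine ⟨Or.inr (.refl _ _), Or.inl ?_⟩
        have := sameCycle_apply_self τ x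
        rwa [hτ, Perm.mul_apply, swap_apply_left] at this
      · left
        have := sameCycle_apply_self τ z
        rwa [hτ, Perm.mul_apply, swap_apply_of_ne_of_ne h1 h2] at this
  let sσ := Perm.SameCycle.setoid σ
  let sτ := Perm.SameCycle.setoid τ
  let p : Quotient sτ → Quotient sσ := Quotient.map id fun _ _ => hle
  -- The new cycle of `y` is the additional one; the new cycle of `x` represents the old common
  -- cycle.
  let f : Quotient sτ → Option (Quotient sσ) := fun q => if q = ⟦y⟧ then none else some (p q)
  have hxy' : (⟦x⟧ : Quotient sτ) ≠ ⟦y⟧ := fun h => hn (Quotient.exact h)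
  have hf : Function.Bijective f := by
    constructor
    · intro q q' hqq
      by_cases h1 : q = ⟦y⟧ <;> by_cases h2 : q' = ⟦y⟧
      · rw [h1, h2]
      · simp [f, h1, h2] at hqq
      · simp [f, h1, h2] at hqq
      · simp only [f, h1, h2, if_false, Option.some.injEq] at hqq
        induction q using Quotient.inductionOn with | _ a
        induction q' using Quotient.inductionOn with | _ b
        have hab : σ.SameCycle a b := Quotient.exact (s := sσ) hqq
        rcases hge hab with h3 | ⟨h3, h4⟩
        · exact Quotient.sound (s := sτ) h3
        · have h3' := h3.resolve_right fun h => h1 (Quotient.sound (s := sτ) h.symm)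
          have h4' := h4.resolve_right fun h => h2 (Quotient.sound (s := sτ) h.symm)
          exact Quotient.sound (s := sτ) (h3'.symm.trans h4')
    · rintro (_ | q)
      · exact ⟨⟦y⟧, if_pos rfl⟩
      · induction q using Quotient.inductionOn with | _ a
        by_cases h1 : (⟦a⟧ : Quotient sτ) = ⟦y⟧
        · refine ⟨⟦x⟧, ?_⟩
          simp only [f, hxy', if_false, Option.some.injEq]
          exact Quotient.sound (s := sσ) (h.trans (hle (Quotient.exact h1)).symm)
        · exact ⟨⟦a⟧, by simp only [f, h1, if_false]; rfl⟩
  have := Nat.card_congr (Equiv.ofBijective f hf)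
  rw [Finite.card_option] at this
  exact this

/-- Multiplication by a transposition of two points of different cycles joins the cycles. -/
theorem numCycles_mul_swap_of_not_sameCycle {D : Type*} [DecidableEq D] [Finite D] {σ : Perm D}
    {x y : D} (h : ¬ σ.SameCycle x y) : numCycles (σ * swap x y) + 1 = numCycles σ := by
  have hxy : x ≠ y := fun e => h (e ▸ .refl _ _)
  -- Joining is the inverse of splitting: a second multiplication by the same transposition recovers
  -- `σ`.
  have := numCycles_mul_swap_of_sameCycle hxy (sameCycle_mul_swap h)
  rw [mul_assoc, swap_mul_self, mul_one] at this
  exact this.symm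

/-! ### Cycles and induced permutations -/

theorem inducedPerm_eq_of {D : Type*} [Finite D] (σ : Perm D) (S : Set D) {d d' : S} {n : ℕ}
    (hn : 0 < n) (h : (σ ^ n) d = d') (hlt : ∀ i, 0 < i → i < n → (σ ^ i) (d : D) ∉ S) :
    inducedPerm σ S d = d' := by
  have h1 : returnTime σ S d = n := by
    refine le_antisymm (returnTime_le σ S d hn (h ▸ d'.2)) (not_lt.mp fun hl => ?_)
    exact hlt _ (returnTime_pos σ S d) hl (returnTime_mem σ S d)
  exact Subtype.ext (by rw [inducedPerm_apply, h1, h])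

theorem pow_notMem_of_lt_returnTime {D : Type*} [Finite D] (σ : Perm D) (S : Set D) (d : S) {i : ℕ}
    (hi : 0 < i) (h : i < returnTime σ S d) : (σ ^ i) (d : D) ∉ S :=
  fun hm => absurd (returnTime_le σ S d hi hm) (not_le.mpr h)

/-- The permutation induced by `σ * τ`, where `τ` moves only points of the subset. -/
theorem inducedPerm_mul {D : Type*} [Finite D] (σ τ : Perm D) (S : Set D) (τS : Perm S)
    (h1 : ∀ d : S, (τS d : D) = τ d) (h2 : ∀ d, d ∉ S → τ d = d) :
    inducedPerm (σ * τ) S = inducedPerm σ S * τS := by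
  refine Equiv.ext fun d => ?_
  -- After the first step the orbit stays outside `S` until it returns, and there `τ` acts
  -- trivially.
  have key : ∀ i, i < returnTime σ S (τS d) →
      ((σ * τ) ^ (i + 1)) (d : D) = (σ ^ (i + 1)) (τS d : D) := by
    intro i hi
    induction i with
    | zero => simp [h1]
    | succ i ih =>
      rw [pow_succ', Perm.mul_apply, ih (by omega), Perm.mul_apply,
        h2 _ (pow_notMem_of_lt_returnTime σ S _ (by omega) hi), ← Perm.mul_apply, ← pow_succ']
  have hp := returnTime_pos σ S (τS d)
  refine inducedPerm_eq_of _ _ hp ?_ fun i hi hlt => ?_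
  · have := key (returnTime σ S (τS d) - 1) (by omega)
    rwa [Nat.sub_add_cancel hp] at this
  · have := key (i - 1) (by omega)
    rw [Nat.sub_add_cancel hi] at this
    rw [this]
    exact pow_notMem_of_lt_returnTime σ S _ hi hlt

/-- The number of cycles of a permutation that do not meet a subset. -/
def numCyclesAvoiding {D : Type*} (σ : Perm D) (S : Set D) : ℕ :=
  Nat.card {q : Quotient (Perm.SameCycle.setoid σ) // ∀ d ∈ S, q ≠ Quotient.mk _ d}

/-- The cycles of the induced permutation are the traces on `S` of the cycles that meet `S`. -/
theorem numCycles_eq_inducedPerm_add {D : Type*} [Finite D] (σ : Perm D) (S : Set D) :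
    numCycles σ = numCycles (inducedPerm σ S) + numCyclesAvoiding σ S := by
  classical
  let Q := Quotient (Perm.SameCycle.setoid σ)
  let p : Q → Prop := fun q => ∀ d ∈ S, q ≠ Quotient.mk _ d
  let f : Quotient (Perm.SameCycle.setoid (inducedPerm σ S)) → {q : Q // ¬ p q} :=
    Quotient.lift (fun d => ⟨Quotient.mk _ d.1, fun h => h d.1 d.2 rfl⟩) fun a b h =>
      Subtype.ext (Quotient.sound (s := Perm.SameCycle.setoid σ)
        ((inducedPerm_sameCycle_iff σ S a b).mp h))
  have hf : Function.Bijective f := by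
    constructor
    · intro a b
      refine Quotient.inductionOn₂ a b fun a b h => ?_
      refine Quotient.sound (s := Perm.SameCycle.setoid (inducedPerm σ S)) ?_
      exact (inducedPerm_sameCycle_iff σ S a b).mpr
        (Quotient.exact (s := Perm.SameCycle.setoid σ) (congrArg Subtype.val h))
    · rintro ⟨q, hq⟩
      have : ∃ d ∈ S, q = Quotient.mk _ d := by simpa [p] using hq
      obtain ⟨d, hd, rfl⟩ := this
      exact ⟨Quotient.mk _ ⟨d, hd⟩, rfl⟩
  rw [numCycles, numCycles, Nat.card_congr (Equiv.ofBijective f hf), numCyclesAvoiding, add_comm,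
    ← Nat.card_sum]
  exact Nat.card_congr (Equiv.sumCompl p).symm

theorem sameCycle_congr_of_avoiding {D : Type*} [Finite D] {σ ρ : Perm D} {S : Set D}
    (h : ∀ d, d ∉ S → ρ d = σ d) {d : D} (hd : ∀ s ∈ S, ¬ σ.SameCycle d s) (d' : D) :
    σ.SameCycle d d' ↔ ρ.SameCycle d d' := by
  have key : ∀ n : ℕ, (ρ ^ n) d = (σ ^ n) d := by
    intro n
    induction n with
    | zero => rfl
    | succ n ih =>
      rw [pow_succ', pow_succ', Perm.mul_apply, Perm.mul_apply, ih]
      exact h _ fun hm => hd _ hm ⟨n, by rw [zpow_natCast]⟩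
  constructor
  · intro hs
    obtain ⟨n, rfl⟩ := hs.exists_nat_pow_eq
    exact ⟨n, by rw [zpow_natCast, key]⟩
  · intro hs
    obtain ⟨n, rfl⟩ := hs.exists_nat_pow_eq
    exact ⟨n, by rw [zpow_natCast, key]⟩

/-- A cycle of `σ` that avoids `S` is also a cycle of `ρ`, since only values on `S` can differ. -/
theorem numCyclesAvoiding_le {D : Type*} [Finite D] {σ ρ : Perm D} {S : Set D}
    (h : ∀ d, d ∉ S → ρ d = σ d) : numCyclesAvoiding σ S ≤ numCyclesAvoiding ρ S := by
  have hs : ∀ q : {q : Quotient (Perm.SameCycle.setoid σ) // ∀ d ∈ S, q ≠ Quotient.mk _ d},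
      ∀ s ∈ S, ¬ σ.SameCycle q.1.out s := fun q s hs h =>
    q.2 s hs (q.1.out_eq.symm.trans (Quotient.sound (s := Perm.SameCycle.setoid σ) h))
  refine Nat.card_le_card_of_injective (fun q => ⟨Quotient.mk _ q.1.out, fun s hsS he => ?_⟩)
    fun q q' he => ?_
  · exact hs q s hsS ((sameCycle_congr_of_avoiding h (hs q) s).mpr (Quotient.exact he))
  · have h1 := Quotient.exact (congrArg Subtype.val he)
    have h2 := (sameCycle_congr_of_avoiding h (hs q) q'.1.out).mpr h1
    refine Subtype.ext ?_
    rw [← q.1.out_eq, ← q'.1.out_eq]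
    exact Quotient.sound (s := Perm.SameCycle.setoid σ) h2

theorem numCyclesAvoiding_congr {D : Type*} [Finite D] {σ ρ : Perm D} {S : Set D}
    (h : ∀ d, d ∉ S → ρ d = σ d) : numCyclesAvoiding σ S = numCyclesAvoiding ρ S :=
  le_antisymm (numCyclesAvoiding_le h) (numCyclesAvoiding_le fun d hd => (h d hd).symm)

/-! ### Faces of spanning sub-dessins -/

namespace Dessin

variable {V E D : Type*}

theorem edge_flip (G : Dessin V E D) (d : D) : G.edge (G.flip d) = G.edge d :=
  ((G.edge_eq_iff _ _).mpr (Or.inr rfl)).symm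

/-- The vertices without darts. -/
abbrev Isolated (G : Dessin V E D) : Type _ := {v : V // ∀ d, G.vert d ≠ v}

theorem card_vertices [Finite V] (G : Dessin V E D) :
    Nat.card V = numCycles G.rot + Nat.card G.Isolated := by
  classical
  let p : V → Prop := fun v => ∀ d, G.vert d ≠ v
  let f : Quotient (Perm.SameCycle.setoid G.rot) → {v // ¬ p v} :=
    Quotient.lift (fun d => ⟨G.vert d, fun h => h d rfl⟩) fun a b h =>
      Subtype.ext ((G.vert_eq_iff a b).mpr h)
  have hf : Function.Bijective f := by
    constructor
    · intro a b
      refine Quotient.inductionOn₂ a b fun a b h => ?_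
      exact Quotient.sound (s := Perm.SameCycle.setoid G.rot)
        ((G.vert_eq_iff a b).mp (congrArg Subtype.val h))
    · rintro ⟨v, hv⟩
      have : ∃ d, G.vert d = v := by simpa [p] using hv
      obtain ⟨d, rfl⟩ := this
      exact ⟨Quotient.mk _ d, rfl⟩
  rw [numCycles, Nat.card_congr (Equiv.ofBijective f hf), add_comm, ← Nat.card_sum]
  exact Nat.card_congr (Equiv.sumCompl p).symm

open Classical in
/-- The involution of the darts that flips the edges in `H` and fixes the darts of all others. -/
def flipOn (G : Dessin V E D) (H : Finset E) : Perm D :=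
  Function.Involutive.toPerm (fun d => if G.edge d ∈ H then G.flip d else d) fun d => by
    by_cases h : G.edge d ∈ H
    · simp [h, G.edge_flip, G.flip_flip]
    · simp [h]

theorem flipOn_of_mem (G : Dessin V E D) {H : Finset E} {d : D} (h : G.edge d ∈ H) :
    G.flipOn H d = G.flip d := if_pos h

theorem flipOn_of_notMem (G : Dessin V E D) {H : Finset E} {d : D} (h : G.edge d ∉ H) :
    G.flipOn H d = d := if_neg h

/-- The number of faces of the spanning sub-dessin with edge set `H`, computed on all darts. -/
def faceCount (G : Dessin V E D) (H : Finset E) : ℕ :=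
  numCycles (G.rot * G.flipOn H) + Nat.card G.Isolated

/-- Deleting the edges outside `R` loses the face cycles that avoid the darts of `R`. There the face
permutation agrees with `rot`, so these cycles are exactly the vertices that become isolated, and
the extra term compensates for them. -/
theorem faceCount_eq_inducedPerm [Finite V] [Finite D] (G : Dessin V E D) {H R : Finset E}
    (h : H ⊆ R) : G.faceCount H =
      numCycles (inducedPerm (G.rot * G.flipOn H) {d : D | G.edge d ∈ R}) +
        Nat.card (G.sub R).Isolated := by
  have h1 := G.card_vertices
  have h2 := (G.sub R).card_vertices
  have h3 := numCycles_eq_inducedPerm_add G.rot {d : D | G.edge d ∈ R}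
  have h4 := numCycles_eq_inducedPerm_add (G.rot * G.flipOn H) {d : D | G.edge d ∈ R}
  have h5 : numCyclesAvoiding G.rot {d : D | G.edge d ∈ R} =
      numCyclesAvoiding (G.rot * G.flipOn H) {d : D | G.edge d ∈ R} :=
    numCyclesAvoiding_congr fun d hd => by
      rw [Perm.mul_apply, G.flipOn_of_notMem fun hm => hd (h hm)]
  have h6 : numCycles (G.sub R).rot = numCycles (inducedPerm G.rot {d : D | G.edge d ∈ R}) := rfl
  rw [faceCount]
  omega

theorem numFaces_sub [Finite V] [Finite D] (G : Dessin V E D) (H : Finset E) :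
    (G.sub H).numFaces = G.faceCount H := by
  rw [G.faceCount_eq_inducedPerm subset_rfl, inducedPerm_mul _ _ _ (G.sub H).flip
    (fun d => (G.flipOn_of_mem d.2).symm) (fun d hd => G.flipOn_of_notMem hd)]
  rfl

/-- This handles the iterated deletion: a sub-dessin of the collapsed dessin is compared directly
with the original one. -/
theorem faceCount_sub [Finite V] [Finite D] (G : Dessin V E D) (R : Finset E)
    (H : Finset {e // e ∈ R}) :
    (G.sub R).faceCount H = G.faceCount (H.map (Function.Embedding.subtype _)) := by
  have hR : H.map (Function.Embedding.subtype _) ⊆ R := by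
    intro e he
    obtain ⟨e, -, rfl⟩ := Finset.mem_map.mp he
    exact e.2
  have hmem : ∀ d : {d : D | G.edge d ∈ R}, G.edge d ∈ H.map (Function.Embedding.subtype _) ↔
      (G.sub R).edge d ∈ H := by
    intro d
    rw [Finset.mem_map]
    constructor
    · rintro ⟨e, he, h⟩
      have : e = (G.sub R).edge d := Subtype.ext h
      exact this ▸ he
    · exact fun h => ⟨_, h, rfl⟩
  rw [G.faceCount_eq_inducedPerm hR, inducedPerm_mul _ _ _ ((G.sub R).flipOn H)]
  · rfl
  · intro d
    by_cases h : (G.sub R).edge d ∈ H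
    · rw [flipOn_of_mem _ h, flipOn_of_mem _ ((hmem d).mpr h)]; rfl
    · rw [flipOn_of_notMem _ h, flipOn_of_notMem _ (mt (hmem d).mp h)]
  · exact fun d hd => G.flipOn_of_notMem fun h => hd (hR h)

theorem faceCount_empty [Finite V] (G : Dessin V E D) : G.faceCount ∅ = Nat.card V := by
  rw [G.card_vertices, faceCount]
  congr 2

/-- This turns the insertion of an edge into multiplication by a transposition, so that the
splitting and joining of cycles applies to faces. -/
theorem flipOn_insert [DecidableEq E] [DecidableEq D] (G : Dessin V E D) {H : Finset E} {x : D}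
    (hx : G.edge x ∉ H) : G.flipOn (insert (G.edge x) H) = G.flipOn H * swap x (G.flip x) := by
  refine Equiv.ext fun d => ?_
  rw [Perm.mul_apply]
  by_cases h : G.edge d = G.edge x
  · rw [G.flipOn_of_mem (by simp [h])]
    rcases (G.edge_eq_iff x d).mp h.symm with rfl | rfl
    · rw [swap_apply_left, G.flipOn_of_notMem (by rwa [G.edge_flip])]
    · rw [swap_apply_right, G.flipOn_of_notMem hx, G.flip_flip]
  · rw [swap_apply_of_ne_of_ne (fun e => h (by rw [e])) (fun e => h (by rw [e, G.edge_flip]))]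
    by_cases hd : G.edge d ∈ H
    · rw [G.flipOn_of_mem (by simp [hd]), G.flipOn_of_mem hd]
    · rw [G.flipOn_of_notMem (by simp [h, hd]), G.flipOn_of_notMem hd]

theorem faceCount_insert_of_sameCycle [DecidableEq E] [Finite D] (G : Dessin V E D) {H : Finset E}
    {x : D} (hx : G.edge x ∉ H) (h : (G.rot * G.flipOn H).SameCycle x (G.flip x)) :
    G.faceCount (insert (G.edge x) H) = G.faceCount H + 1 := by
  classical
  rw [faceCount, faceCount, G.flipOn_insert hx, ← mul_assoc,
    numCycles_mul_swap_of_sameCycle (G.flip_ne x).symm h]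
  omega

theorem faceCount_insert [DecidableEq E] [Finite D] (G : Dessin V E D) {H : Finset E} {e : E}
    (he : e ∉ H) : G.faceCount (insert e H) = G.faceCount H + 1 ∨
      G.faceCount (insert e H) + 1 = G.faceCount H := by
  classical
  obtain ⟨x, rfl⟩ := G.edge_surjective e
  by_cases h : (G.rot * G.flipOn H).SameCycle x (G.flip x)
  · exact Or.inl (G.faceCount_insert_of_sameCycle he h)
  · right
    rw [faceCount, faceCount, G.flipOn_insert he, ← mul_assoc]
    have := numCycles_mul_swap_of_not_sameCycle h
    omega

/-- Every insertion changes the number of edges by one and the number of faces by plus or minus one.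
The parity makes the integer division in the definition of the genus exact. -/
theorem even_faceCount [Finite V] [Finite D] (G : Dessin V E D) (H : Finset E) :
    Even (Nat.card V + H.card + G.faceCount H) := by
  classical
  induction H using Finset.induction_on with
  | empty => rw [G.faceCount_empty]; simp
  | insert e H he ih =>
    rw [Finset.card_insert_of_notMem he]
    rw [Nat.even_iff] at ih ⊢
    rcases G.faceCount_insert he with h | h <;> omega

/-! ### Parallel edges and the genus -/

/-- Adding an edge which is neighbouring and parallel to an edge already present adds a face. -/
theorem NeighbouringParallel.faceCount_insert_right [DecidableEq E] [Finite D] {G : Dessin V E D}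
    {e e' : E} (h : G.NeighbouringParallel e e') {H : Finset E} (he : e ∈ H) (he' : e' ∉ H) :
    G.faceCount (insert e' H) = G.faceCount H + 1 := by
  obtain ⟨d, rfl, rfl, hd⟩ := h
  refine G.faceCount_insert_of_sameCycle he' (Perm.SameCycle.symm ?_)
  -- The boundary walk passes `flip (rot d)`, `flip d`, `rot d` in succession: the first edge of the
  -- pair is flipped, the second is not yet.
  refine Perm.SameCycle.trans (y := G.flip d) ?_ ?_
  · have := sameCycle_apply_self (G.rot * G.flipOn H) (G.flip (G.rot d))
    rwa [Perm.mul_apply, G.flipOn_of_notMem (by rwa [G.edge_flip]), hd] at this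
  · have := sameCycle_apply_self (G.rot * G.flipOn H) (G.flip d)
    rwa [Perm.mul_apply, G.flipOn_of_mem (by rwa [G.edge_flip]), G.flip_flip] at this

theorem NeighbouringParallel.faceCount_insert_left [DecidableEq E] [Finite D] {G : Dessin V E D}
    {e e' : E} (h : G.NeighbouringParallel e e') {H : Finset E} (he : e ∉ H) (he' : e' ∈ H) :
    G.faceCount (insert e H) = G.faceCount H + 1 := by
  obtain ⟨d, rfl, rfl, hd⟩ := h
  refine G.faceCount_insert_of_sameCycle he ?_
  -- Here the walk is `d`, `rot d`, `flip d`, as only the second edge is flipped.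
  refine Perm.SameCycle.trans (y := G.rot d) ?_ ?_
  · have := sameCycle_apply_self (G.rot * G.flipOn H) d
    rwa [Perm.mul_apply, G.flipOn_of_notMem he] at this
  · have := sameCycle_apply_self (G.rot * G.flipOn H) (G.rot d)
    rwa [Perm.mul_apply, G.flipOn_of_mem he', hd] at this

/-- The number of edges minus the number of faces of a spanning sub-dessin. -/
def edgesSubFaces (G : Dessin V E D) (H : Finset E) : ℤ := H.card - G.faceCount H

/-- Both directions, for all `H` at once, are needed for the induction over the generated
equivalence relation. -/
theorem Parallel.edgesSubFaces_insert [DecidableEq E] [Finite D] {G : Dessin V E D} {e e' : E}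
    (h : G.Parallel e e') : ∀ H : Finset E, (e ∈ H →
      G.edgesSubFaces (insert e' H) = G.edgesSubFaces H) ∧ (e' ∈ H →
      G.edgesSubFaces (insert e H) = G.edgesSubFaces H) := by
  induction h with
  | rel x y h =>
    refine fun H => ⟨fun hx => ?_, fun hy => ?_⟩
    · by_cases hy : y ∈ H
      · rw [Finset.insert_eq_self.mpr hy]
      · rw [edgesSubFaces, edgesSubFaces, h.faceCount_insert_right hx hy,
          Finset.card_insert_of_notMem hy]
        push_cast; ring
    · by_cases hx : x ∈ H
      · rw [Finset.insert_eq_self.mpr hx]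
      · rw [edgesSubFaces, edgesSubFaces, h.faceCount_insert_left hx hy,
          Finset.card_insert_of_notMem hx]
        push_cast; ring
  | refl x => exact fun H => ⟨fun h => by rw [Finset.insert_eq_self.mpr h],
      fun h => by rw [Finset.insert_eq_self.mpr h]⟩
  | symm x y _ ih => exact fun H => (ih H).symm
  | trans x y z _ _ ih1 ih2 =>
    refine fun H => ⟨fun hx => ?_, fun hz => ?_⟩
    -- The intermediate edge `y` need not lie in `H`: it is inserted next to `x`, then `z` next to
    -- `y`, and finally `y` is removed again, being parallel to `z`.
    · have h1 := (ih1 H).1 hx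
      have h2 := (ih2 (insert y H)).1 (by simp)
      have h3 := (ih2 (insert z H)).2 (by simp)
      rw [Finset.insert_comm] at h2
      rw [← h3, Finset.insert_comm, Finset.insert_comm z y, h2, h1]
    · have h1 := (ih2 H).2 hz
      have h2 := (ih1 (insert y H)).2 (by simp)
      have h3 := (ih1 (insert x H)).1 (by simp)
      rw [← h3, Finset.insert_comm, h2, h1]

theorem edgesSubFaces_union [DecidableEq E] [Finite D] (G : Dessin V E D) (H K : Finset E)
    (h : ∀ e' ∈ K, ∃ e ∈ H, G.Parallel e e') : G.edgesSubFaces (K ∪ H) = G.edgesSubFaces H := by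
  induction K using Finset.induction_on with
  | empty => rw [Finset.empty_union]
  | insert a K ha ih =>
    rw [Finset.insert_union]
    obtain ⟨e, he, hp⟩ := h a (by simp)
    rw [(hp.edgesSubFaces_insert _).1 (by simp [he]),
      ih fun e' he' => h e' (Finset.mem_insert_of_mem he')]

/-- The difference of the numbers of edges and faces depends only on the classes of parallel
edges that are met. -/
theorem edgesSubFaces_congr [Finite D] (G : Dessin V E D) {H K : Finset E}
    (h : ∀ e' ∈ K, ∃ e ∈ H, G.Parallel e e') (h' : ∀ e' ∈ H, ∃ e ∈ K, G.Parallel e e') :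
    G.edgesSubFaces H = G.edgesSubFaces K := by
  classical
  rw [← G.edgesSubFaces_union H K h, ← G.edgesSubFaces_union K H h', Finset.union_comm]

theorem numComponents_of_card_eq_one (G : Dessin V E D) (h : Nat.card V = 1) :
    G.numComponents = 1 := by
  obtain ⟨h1, ⟨v⟩⟩ := Nat.card_eq_one_iff_unique.mp h
  refine Nat.card_eq_one_iff_unique.mpr ⟨⟨fun a b => ?_⟩, ⟨Quot.mk _ v⟩⟩
  induction a using Quot.ind
  induction b using Quot.ind
  exact congrArg _ (Subsingleton.elim _ _)

theorem two_mul_genus_sub [Finite V] [Finite D] (G : Dessin V E D) (h : Nat.card V = 1)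
    (H : Finset E) : 2 * (G.sub H).genus = 1 + G.edgesSubFaces H := by
  have h1 : ((G.sub H).numEdges : ℤ) = H.card := by
    rw [numEdges, Nat.card_eq_fintype_card, Fintype.card_coe]
  have h2 := G.even_faceCount H
  rw [genus, numComponents_of_card_eq_one _ h, numVertices, h, h1, G.numFaces_sub, edgesSubFaces]
  rw [h, Nat.even_iff] at h2
  omega

end Dessin

/-! ### State circles as faces -/

/-- The orbits of two involutions which both exchange the two colours of a colouring correspond to
the cycles of their product on the points of one colour. -/
theorem card_orbits_eq_numCycles {X : Type*} {a b : Perm X} (ha : ∀ x, a (a x) = x)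
    (hb : ∀ x, b (b x) = x) {color : X → Bool} (hca : ∀ x, color (a x) = !color x)
    (hcb : ∀ x, color (b x) = !color x) (σ : Perm {x // color x = true})
    (hσ : ∀ x, (σ x : X) = b (a x)) :
    Nat.card (Quotient (MulAction.orbitRel (Subgroup.closure {a, b}) X)) = numCycles σ := by
  -- Each `b`-orbit is represented by its point of colour `true`. Then `b` does not change the
  -- representative, and `a` moves it by one `σ`-step forwards or backwards.
  let rep : X → {x // color x = true} := fun x =>
    if h : color x = true then ⟨x, h⟩ else ⟨b x, by rw [hcb]; simpa using h⟩
  have rep_true : ∀ x (h : color x = true), rep x = ⟨x, h⟩ := fun x h => dif_pos h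
  have rep_false : ∀ x (h : color x = false), (rep x : X) = b x := fun x h => by
    simp [rep, h]
  let r : X → X → Prop := fun x y => σ.SameCycle (rep x) (rep y)
  have hrb : ∀ x, r x (b x) := by
    intro x
    have : rep (b x) = rep x := by
      rcases Bool.eq_false_or_eq_true (color x) with h | h
      · refine Subtype.ext ?_
        rw [rep_false (b x) (by rw [hcb, h]; rfl), rep_true x h, hb]
      · refine Subtype.ext ?_
        rw [rep_true (b x) (by rw [hcb, h]; rfl), rep_false x h]
    change σ.SameCycle _ _
    rw [this]
  have hra : ∀ x, r x (a x) := by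
    intro x
    change σ.SameCycle _ _
    rcases Bool.eq_false_or_eq_true (color x) with h | h
    · have : rep (a x) = σ (rep x) := by
        refine Subtype.ext ?_
        rw [rep_false (a x) (by rw [hca, h]; rfl), rep_true x h, hσ]
      rw [this]
      exact sameCycle_apply_self _ _
    · have : rep x = σ (rep (a x)) := by
        refine Subtype.ext ?_
        rw [hσ, rep_true (a x) (by rw [hca, h]; rfl), rep_false x h, ha]
      rw [this]
      exact (sameCycle_apply_self _ _).symm
  have hr : ∀ g ∈ Subgroup.closure {a, b}, ∀ x, r x (g x) := by
    intro g hg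
    induction hg using Subgroup.closure_induction with
    | mem y hy =>
      rcases hy with rfl | rfl
      · exact hra
      · exact hrb
    | one => exact fun x => Perm.SameCycle.refl _ _
    | mul g g' _ _ h h' => exact fun x => (h' x).trans (h (g' x))
    | inv g _ h =>
      intro x
      have := h (g⁻¹ x)
      rw [← Perm.mul_apply, mul_inv_cancel, Perm.one_apply] at this
      exact this.symm
  have hmem : ∀ g ∈ ({a, b} : Set (Perm X)), ∀ x,
      (Quotient.mk (MulAction.orbitRel (Subgroup.closure {a, b}) X) (g x)) = Quotient.mk _ x :=
    fun g hg x => Quotient.sound ⟨⟨g, Subgroup.subset_closure hg⟩, rfl⟩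
  let f : Quotient (Perm.SameCycle.setoid σ) →
      Quotient (MulAction.orbitRel (Subgroup.closure {a, b}) X) :=
    Quotient.lift (fun d => Quotient.mk _ d.1) fun x y h => by
      refine sameCycle_of_step (eq_equivalence.comap fun x : {x // color x = true} =>
        Quotient.mk (MulAction.orbitRel (Subgroup.closure {a, b}) X) x.1) (fun z => ?_) h
      change Quotient.mk _ z.1 = Quotient.mk _ (σ z).1
      rw [hσ, hmem b (by simp), hmem a (by simp)]
  refine (Nat.card_congr (Equiv.ofBijective f ⟨fun x y => ?_, fun q => ?_⟩)).symm
  · refine Quotient.inductionOn₂ x y fun x y h => ?_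
    obtain ⟨⟨g, hg⟩, h1⟩ := Quotient.exact h
    have h2 := hr g hg y.1
    have h3 : g y.1 = x.1 := h1
    change σ.SameCycle _ _ at h2
    rw [h3, rep_true x.1 x.2, rep_true y.1 y.2] at h2
    exact Quotient.sound (s := Perm.SameCycle.setoid σ) h2.symm
  · induction q using Quotient.inductionOn with | _ x
    rcases Bool.eq_false_or_eq_true (color x) with h | h
    · exact ⟨Quotient.mk _ ⟨x, h⟩, rfl⟩
    · exact ⟨Quotient.mk _ ⟨b x, by rw [hcb, h]; rfl⟩, hmem b (by simp) x⟩

/-- The two splicings differ by a half-turn of the crossing, which is the flip of the dessin. -/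
theorem joinB_eq (i : ZMod 4) : joinB i = joinA i + 2 := by
  revert i; unfold joinA joinB; decide

theorem joinB_joinB (i : ZMod 4) : joinB (joinB i) = i := by
  revert i; unfold joinB; decide

open Classical in
theorem splice_apply {C : Type*} (s : Finset C) (h : C × ZMod 4) :
    splice s h = (h.1, if h.1 ∈ s then joinB h.2 else joinA h.2) := by
  obtain ⟨c, i⟩ := h
  by_cases hc : c ∈ s <;> simp [splice, hc]

theorem splice_splice {C : Type*} (s : Finset C) (h : C × ZMod 4) :
    splice s (splice s h) = h := by
  rw [splice_apply, splice_apply]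
  by_cases hc : h.1 ∈ s
  · simp [hc, joinB_joinB]
  · simp [hc, LinkDiagram.joinA_joinA]

namespace LinkDiagram

variable {C : Type*} {P : LinkDiagram C}

namespace Shading

variable (κ : P.Shading)

theorem splice_eq_of_mem {s : Finset C} {h : C × ZMod 4} (hs : h.1 ∈ s) :
    splice s h = ((splice (∅ : Finset C) h).1, (splice (∅ : Finset C) h).2 + 2) := by
  rw [splice_apply, splice_empty_apply, if_pos hs, joinB_eq]

theorem splice_eq_of_notMem {s : Finset C} {h : C × ZMod 4} (hs : h.1 ∉ s) :
    splice s h = splice (∅ : Finset C) h := by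
  rw [splice_apply, splice_empty_apply, if_neg hs]

theorem shade_splice_state (s : Finset C) (h : C × ZMod 4) :
    κ.shade (splice s h) = !κ.shade h := by
  by_cases hs : h.1 ∈ s
  · rw [splice_eq_of_mem hs, κ.shade_add_two]
    exact κ.shade_splice h
  · rw [splice_eq_of_notMem hs, κ.shade_splice]

/-- Gluing and splicing are involutions that both exchange the shades. On the outgoing half-edges
their product is `rot` followed by the flips at the crossings in `s`, a conjugate of the face
permutation. -/
theorem card_circleSetoid (s : Finset C) :
    Nat.card (Quotient (P.circleSetoid s)) =
      numCycles ((P.dessinA κ).rot * (P.dessinA κ).flipOn s) := by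
  rw [numCycles_mul_comm]
  refine card_orbits_eq_numCycles P.glue_glue (splice_splice s) κ.shade_glue
    (κ.shade_splice_state s) _ fun x => ?_
  have h1 : (((P.dessinA κ).rot x : κ.Out) : C × ZMod 4) = splice ∅ (P.glue x) := rfl
  have h2 : (P.dessinA κ).edge ((P.dessinA κ).rot x) = (P.glue x).1 := by
    change ((P.dessinA κ).rot x).1.1 = _
    rw [h1, splice_empty_apply]
  rw [Perm.mul_apply]
  by_cases hs : (P.glue x).1 ∈ s
  · rw [Dessin.flipOn_of_mem _ (h2 ▸ hs), splice_eq_of_mem hs, ← h1]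
    exact κ.opposite_val _
  · rw [Dessin.flipOn_of_notMem _ (h2 ▸ hs), splice_eq_of_notMem hs, h1]

/-- The circles of a Kauffman state are the faces of the corresponding spanning sub-dessin. -/
theorem card_circle [Finite C] (s : Finset C) :
    Nat.card (P.Circle s) = (P.dessinA κ).faceCount s := by
  have key : ∀ s : Finset C, Nat.card (P.Circle s) =
      numCycles ((P.dessinA κ).rot * (P.dessinA κ).flipOn s) + Nat.card (PLift (IsEmpty C)) :=
    fun s => by rw [Nat.card_sum, κ.card_circleSetoid]
  -- The empty state shows that the circle added when there are no crossings is counted by the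
  -- isolated vertices.
  have h1 := key ∅
  rw [← (P.dessinA κ).faceCount_empty, Dessin.faceCount] at h1
  rw [key, Dessin.faceCount]
  omega

end Shading

instance (s : Finset C) : Nonempty (P.Circle s) := by
  rcases isEmpty_or_nonempty C with h | ⟨⟨c⟩⟩
  · exact ⟨Sum.inr ⟨h⟩⟩
  · exact ⟨Sum.inl (Quotient.mk _ (c, 0))⟩

end LinkDiagram

/-! ### Sums over the fibres of the image map -/

/-- The uniqueness part of Möbius inversion on the subset lattice. -/
theorem eq_of_forall_sum_powerset_eq {ι M : Type*} [DecidableEq ι] [AddCommGroup M]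
    {a b : Finset ι → M} (h : ∀ H : Finset ι, ∑ K ∈ H.powerset, a K = ∑ K ∈ H.powerset, b K)
    (H : Finset ι) : a H = b H := by
  induction H using Finset.strongInduction with
  | _ H ih =>
    have h1 := h H
    have h2 : H ∈ H.powerset := Finset.mem_powerset_self H
    rw [← Finset.add_sum_erase _ _ h2, ← Finset.add_sum_erase _ _ h2,
      Finset.sum_congr rfl fun K hK => ih K ?_] at h1
    · exact add_right_cancel h1
    · rw [Finset.mem_erase, Finset.mem_powerset] at hK
      exact hK.2.ssubset_of_ne hK.1

/-- Summed over all subsets of `H`, both sides become (1 + y)^n, where n is the size of the preimage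
of `H`: the left by the binomial theorem, the right by expanding a product of factors 1 + (-1 + (1 +
y)^m) over the fibre sizes m. Möbius inversion then gives the identity for `H` itself. -/
theorem sum_pow_card_filter_image {ι κ K : Type*} [Fintype ι] [DecidableEq ι] [DecidableEq κ]
    [CommRing K] (p : ι → κ) (y : K) (H : Finset κ) :
    ∑ s : Finset ι with s.image p = H, y ^ s.card =
      ∏ c ∈ H, (-1 + (1 + y) ^ (Finset.univ.filter fun i => p i = c).card) := by
  refine eq_of_forall_sum_powerset_eq
    (a := fun H => ∑ s : Finset ι with s.image p = H, y ^ s.card)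
    (b := fun H => ∏ c ∈ H, (-1 + (1 + y) ^ (Finset.univ.filter fun i => p i = c).card))
    (fun H => ?_) H
  have h1 : ∑ t ∈ H.powerset, ∑ s : Finset ι with s.image p = t, y ^ s.card =
      ∑ s ∈ (Finset.univ.filter fun i => p i ∈ H).powerset, y ^ s.card := by
    rw [← Finset.sum_fiberwise_of_maps_to (g := fun s : Finset ι => s.image p) (t := H.powerset)]
    · refine Finset.sum_congr rfl fun t ht => Finset.sum_congr ?_ fun _ _ => rfl
      ext s
      simp only [Finset.mem_filter, Finset.mem_univ, true_and, Finset.mem_powerset]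
      refine ⟨fun h => ⟨fun i hi => ?_, h⟩, fun h => h.2⟩
      simp only [Finset.mem_filter, Finset.mem_univ, true_and]
      exact Finset.mem_powerset.mp ht (h ▸ Finset.mem_image_of_mem p hi)
    · intro s hs
      rw [Finset.mem_powerset] at hs ⊢
      intro c hc
      obtain ⟨i, hi, rfl⟩ := Finset.mem_image.mp hc
      exact (Finset.mem_filter.mp (hs hi)).2
  have h2 := Finset.sum_pow_mul_eq_add_pow y 1 (Finset.univ.filter fun i => p i ∈ H)
  simp only [one_pow, mul_one] at h2
  rw [h1, h2, ← Finset.prod_one_add]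
  have h3 : (Finset.univ.filter fun i => p i ∈ H).card =
      ∑ c ∈ H, (Finset.univ.filter fun i => p i = c).card := by
    rw [Finset.card_eq_sum_card_fiberwise (f := p) (t := H) fun i hi => by simpa using hi]
    refine Finset.sum_congr rfl fun c hc => congrArg _ ?_
    ext i
    simp only [Finset.mem_filter, Finset.mem_univ, true_and]
    exact ⟨fun h => h.2, fun h => ⟨h ▸ hc, h⟩⟩
  rw [h3, ← Finset.prod_pow_eq_pow_sum]
  exact Finset.prod_congr rfl fun c _ => by ring

/-! ### Powers of the variable in the field of fractions -/

theorem neg_one_sub_T_ne_zero : (-1 - T (-4) : ℤ[T;T⁻¹]) ≠ 0 := by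
  intro h
  have := congrArg (fun f : ℤ[T;T⁻¹] => f.coeff 0) h
  rw [← T_zero] at this
  simp at this

theorem algebraMap_T_zpow (n : ℤ) : algebraMap ℤ[T;T⁻¹] (FractionRing ℤ[T;T⁻¹]) (T 1) ^ n =
    algebraMap ℤ[T;T⁻¹] (FractionRing ℤ[T;T⁻¹]) (T n) := by
  have key : ∀ m : ℕ, algebraMap ℤ[T;T⁻¹] (FractionRing ℤ[T;T⁻¹]) (T 1) ^ m =
      algebraMap ℤ[T;T⁻¹] (FractionRing ℤ[T;T⁻¹]) (T m) := fun m => by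
    rw [← map_pow, T_pow, mul_one]
  obtain ⟨m, rfl | rfl⟩ := n.eq_nat_or_neg
  · rw [zpow_natCast, key]
  · rw [zpow_neg, zpow_natCast, key]
    refine (eq_inv_of_mul_eq_one_left ?_).symm
    rw [← map_mul, ← T_add, neg_add_cancel, T_zero, map_one]

end

theorem mainTheorem10 {C : Type*} [Fintype C] (P : LinkDiagram C) (κ : P.Shading)
    (hone : (P.dessinA κ).numVertices = 1)
    (R : Finset C) (hR : ∀ e, ∃! c, c ∈ R ∧ (P.dessinA κ).Parallel c e)
    (A : FractionRing ℤ[T;T⁻¹]) (hA : A = algebraMap ℤ[T;T⁻¹] (FractionRing ℤ[T;T⁻¹]) (T 1)) :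
    algebraMap ℤ[T;T⁻¹] (FractionRing ℤ[T;T⁻¹]) P.bracket =
      ∑ H : Finset {c // c ∈ R},
        A ^ (((P.dessinA κ).numEdges : ℤ) - 4 * (((P.dessinA κ).collapse R).sub H).genus) *
        (-1 - A ^ (-4 : ℤ)) ^ (-2 * (((P.dessinA κ).collapse R).sub H).genus) *
        ∏ c ∈ H, (-1 + (-A ^ (-4 : ℤ)) ^ ((P.dessinA κ).collapse R).weight c) := by
  classical
  set G := P.dessinA κ with hG
  have hpow : ∀ n : ℤ, algebraMap ℤ[T;T⁻¹] (FractionRing ℤ[T;T⁻¹]) (T n) = A ^ n := fun n => by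
    rw [hA, algebraMap_T_zpow]
  have hA0 : A ≠ 0 := by
    intro h
    have h1 : A ^ (1 : ℤ) * A ^ (-1 : ℤ) = 1 := by
      rw [← hpow, ← hpow, ← map_mul, ← T_add, add_neg_cancel, T_zero, map_one]
    rw [h] at h1
    simp at h1
  set y : FractionRing ℤ[T;T⁻¹] := -1 - A ^ (-4 : ℤ) with hy
  have hy0 : y ≠ 0 := by
    rw [hy, ← hpow, ← map_one (algebraMap ℤ[T;T⁻¹] (FractionRing ℤ[T;T⁻¹])), ← map_neg, ← map_sub]
    exact (map_ne_zero_iff _ (IsFractionRing.injective _ _)).mpr neg_one_sub_T_ne_zero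
  -- Factoring out A² turns the circle factor into a power of `y`, the quantity in which the sum
  -- over states is binomial.
  have hδ : -A ^ (2 : ℤ) - A ^ (-2 : ℤ) = A ^ (2 : ℤ) * y := by
    rw [hy, mul_sub, ← zpow_add₀ hA0]
    norm_num
  have hV : Nat.card (P.Circle ∅) = 1 := hone
  -- the projection of the chords to the representatives
  choose π hπ hπu using hR
  let p : C → {c // c ∈ R} := fun e => ⟨π e, (hπ e).1⟩
  have hp : ∀ e c, p e = c ↔ G.Parallel c.1 e := by
    intro e c
    constructor
    · rintro rfl; exact (hπ e).2
    · exact fun h => Subtype.ext (hπu e c.1 ⟨c.2, h⟩).symm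
  -- The set `s` and its set of representatives meet the same parallel classes, so they have equal
  -- edges minus faces.
  have hgen : ∀ s : Finset C,
      2 * ((G.collapse R).sub (s.image p)).genus = 1 + G.edgesSubFaces s := by
    intro s
    have h1 : 2 * ((G.collapse R).sub (s.image p)).genus =
        1 + (G.sub R).edgesSubFaces (s.image p) := (G.sub R).two_mul_genus_sub hV _
    rw [h1, Dessin.edgesSubFaces, G.faceCount_sub, ← Finset.card_map (Function.Embedding.subtype _)]
    congr 1
    refine (G.edgesSubFaces_congr ?_ ?_).symm
    · intro e' he'
      obtain ⟨c, hc, rfl⟩ := Finset.mem_map.mp he'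
      obtain ⟨e, he, rfl⟩ := Finset.mem_image.mp hc
      exact ⟨e, he, Relation.EqvGen.symm _ _ ((hp e _).mp rfl)⟩
    · intro e he
      exact ⟨π e, Finset.mem_map.mpr ⟨p e, Finset.mem_image_of_mem p he, rfl⟩, (hp e _).mp rfl⟩
  have hterm : ∀ s : Finset C, algebraMap ℤ[T;T⁻¹] (FractionRing ℤ[T;T⁻¹])
      (T ((Fintype.card C : ℤ) - 2 * s.card) * (-T 2 - T (-2)) ^ (Nat.card (P.Circle s) - 1)) =
      A ^ ((G.numEdges : ℤ) - 4 * ((G.collapse R).sub (s.image p)).genus) *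
        y ^ (-2 * ((G.collapse R).sub (s.image p)).genus) * y ^ s.card := by
    intro s
    have h1 := hgen s
    set g := ((G.collapse R).sub (s.image p)).genus
    have hpos : 0 < Nat.card (P.Circle s) := Nat.card_pos
    -- The truncated subtraction is harmless because every state has a circle.
    have h2 : ((Nat.card (P.Circle s) - 1 : ℕ) : ℤ) = s.card - 2 * g := by
      rw [h1, Dessin.edgesSubFaces, ← κ.card_circle, Nat.cast_sub hpos]
      push_cast; ring
    have hE : (G.numEdges : ℤ) = Fintype.card C := by
      rw [Dessin.numEdges, Nat.card_eq_fintype_card]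
    rw [map_mul, map_pow, map_sub, map_neg, hpow, hpow, hpow, hδ, ← zpow_natCast, h2, mul_zpow,
      ← zpow_mul, ← mul_assoc, ← zpow_add₀ hA0, hE, mul_assoc, ← zpow_natCast y, ← zpow_add₀ hy0]
    -- The exponent of `A` is e - 2|s| + 2(|s| - 2g) = e - 4g; that of `y` is |s| - 2g.
    congr 2 <;> ring
  rw [LinkDiagram.bracket, map_sum, Finset.sum_congr rfl fun s _ => hterm s,
    ← Finset.sum_fiberwise Finset.univ fun s : Finset C => s.image p]
  refine Finset.sum_congr rfl fun H _ => ?_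
  -- On the fibre over `H` the genus is constant, so only y^|s| remains under the sum.
  rw [Finset.sum_congr rfl fun s hs => by rw [(Finset.mem_filter.mp hs).2], ← Finset.mul_sum,
    sum_pow_card_filter_image]
  congr 1
  refine Finset.prod_congr rfl fun c _ => ?_
  have h1 : 1 + y = -A ^ (-4 : ℤ) := by rw [hy]; ring
  have h2 : (Finset.univ.filter fun i => p i = c).card = (G.collapse R).weight c := by
    change _ = Nat.card {e : C // G.Parallel c e}
    rw [← Nat.subtype_card]
    intro e
    simp [hp]
  rw [h1, h2]
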